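/- Let $q\ge 1$ and $\Sigma_q=\{0,1,\dots,q-1\}$, and for $\mathbf{x}\in\Sigma_q^n$ let $\mathcal{L}_1^b(\mathbf{x})\subseteq\Sigma_q^n$ be the fixed-length $b$-burst Levenshtein ball of radius one: the set of all length-$n$ words that can be obtained from $\mathbf{x}$ by deleting a block of $b$ consecutive symbols and then inserting a block of $b$ consecutive symbols (arbitrary symbols of $\Sigma_q$, at an arbitrary position). Let $b\ge 2$ and $n\ge 2b+1$. For every $\mathbf{x}\in\Sigma_q^n$, $$|\mathcal{L}_1^b(\mathbf{x})|\le q^{b-1}(n-b+1)\bigl((n-b+1)(q-1)+1\bigr)=q^{b-1}(q-1)n^2+O(n).$$ If $q\ge 3$, then for every $\mathbf{x}\in\Sigma_q^n$, $$|\mathcal{L}_1^b(\mathbf{x})|\le q^{b-1}(n-b+1)\bigl((n-b+1)(q-1)-1\bigr)+2q^{b-1}-\frac{(n-b)(q^{b-1}-1)}{q-1}+\frac{q^b-q-(b-1)(q-1)}{(q-1)^2}=q^{b-1}(q-1)n^2+O(n),$$ and this inequality is an equality whenever $x_i\ne x_{i+b}$ for all $i\in[1,n-b]$ and $x_i\ne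 x_{i+2b}$ for all $i\in[1,n-2b]$; such words $\mathbf{x}$ exist for every $q\ge3$ and $n\ge 2b+1$, so the bound is attained. The $O(n)$ terms are for $n\to\infty$ with $q$ and $b$ fixed. -/

import Mathlib

open Asymptotics Filter

/-- `z` is obtained from `y` by one burst of `b` deletions: a block of `b` consecutive
symbols is removed. -/
def BurstDeletion {α : Type*} (b : ℕ) (y z : List α) : Prop :=
  ∃ u v w : List α, v.length = b ∧ y = u ++ v ++ w ∧ z = u ++ w

/-- `z` is obtained from `y` by one burst of `b` insertions: a block of `b` consecutive
symbols is inserted at some position, possibly at one of the ends. -/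
def BurstInsertion {α : Type*} (b : ℕ) (y z : List α) : Prop :=
  ∃ u v w : List α, v.length = b ∧ y = u ++ w ∧ z = u ++ v ++ w

/-- The `b`-burst-deletion ball of radius `t`: all words obtained from `x` by exactly `t`
successive bursts of `b` deletions. -/
def burstDeletionBall {α : Type*} (b : ℕ) : ℕ → List α → Set (List α)
  | 0, x => {x}
  | t + 1, x => {z | ∃ y ∈ burstDeletionBall b t x, BurstDeletion b y z}

/-- The `b`-burst-insertion ball of radius `t`: all words obtained from `x` by exactly `t`
successive bursts of `b` insertions. -/
def burstInsertionBall {α : Type*} (b : ℕ) : ℕ → List α → Set (List α)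
  | 0, x => {x}
  | t + 1, x => {z | ∃ y ∈ burstInsertionBall b t x, BurstInsertion b y z}

/-- The fixed-length `b`-burst Levenshtein ball of radius `t` centered at `x`: all words of
the same length `n` obtained from `x` by `t` bursts of `b` deletions followed by `t` bursts of
`b` insertions. -/
def burstLevenshteinBall {α : Type*} {n : ℕ} (b t : ℕ) (x : Fin n → α) : Set (Fin n → α) :=
  {z | ∃ y ∈ burstDeletionBall b t (List.ofFn x), List.ofFn z ∈ burstInsertionBall b t y}

/-- `q^{b-1} (n-b+1) ((n-b+1)(q-1)+1)`. -/
noncomputable def generalBound (q b n : ℕ) : ℝ :=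
  (q : ℝ) ^ (b - 1) * ((n : ℝ) - b + 1) * (((n : ℝ) - b + 1) * ((q : ℝ) - 1) + 1)

/-- `q^{b-1} (n-b+1) ((n-b+1)(q-1)-1) + 2 q^{b-1} - (n-b)(q^{b-1}-1)/(q-1)
  + (q^b - q - (b-1)(q-1))/(q-1)^2`. -/
noncomputable def sharpBound (q b n : ℕ) : ℝ :=
  (q : ℝ) ^ (b - 1) * ((n : ℝ) - b + 1) * (((n : ℝ) - b + 1) * ((q : ℝ) - 1) - 1)
    + 2 * (q : ℝ) ^ (b - 1)
    - ((n : ℝ) - b) * ((q : ℝ) ^ (b - 1) - 1) / ((q : ℝ) - 1)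
    + ((q : ℝ) ^ b - q - ((b : ℝ) - 1) * ((q : ℝ) - 1)) / ((q : ℝ) - 1) ^ 2

/-- The entries of `x` at distance `b` differ, and so do the entries at distance `2b`. -/
def SeparatedWord {α : Type*} {n : ℕ} (b : ℕ) (x : Fin n → α) : Prop :=
  (∀ i j : Fin n, (j : ℕ) = i + b → x i ≠ x j) ∧
    (∀ i j : Fin n, (j : ℕ) = i + 2 * b → x i ≠ x j)

/-! Put m = n - b. The ball is the union of the insertion balls of the m + 1 words `deleteBlock b x
i`, and `ncard_insertions` gives these balls one common size, whatever the word. Their sizes add up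
to `generalBound`, and `ncard_partialBall` says that the true count falls short by exactly the sum
of the sets `overlap`: words of the ball at i + 1 already met earlier. The sharp bound is a lower
bound for that sum. If x_i ≠ x_{i+b}, the overlap at i contains disjoint families of known size:
words equal to x outside a window of b - 1 positions, and `crossWords` for each l with x_l ≠
x_{l+b}. If x_i = x_{i+b}, two consecutive deletions coincide and the overlap is a full insertion
ball, so large that it also pays for the families with l = i lost in every other overlap
(`le_ncard_overlap`). Summed over i, this yields `totalOverlap` for every x. For a separated word
the families cover each overlap (`overlap_subset_of_separated`), whence equality. -/

/-- The words of length `n` that agree with `f` before position `a` and with `g` from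
position `c` on. -/
def cylinder {α : Type*} (n a c : ℕ) (f g : ℕ → α) : Set (Fin n → α) :=
  {z | (∀ t : Fin n, (t : ℕ) < a → z t = f t) ∧ ∀ t : Fin n, c ≤ (t : ℕ) → z t = g t}

/-- The sequence `x` with the block `[i, i + b)` removed. -/
def deleteBlock {α : Type*} (b : ℕ) (x : ℕ → α) (i t : ℕ) : α :=
  if t < i then x t else x (t + b)

/-- The words of length `n` obtained from `y` by inserting a block of length `b` at
position `p`. -/
def insertAt {α : Type*} (n b : ℕ) (y : ℕ → α) (p : ℕ) : Set (Fin n → α) :=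
  cylinder n p (p + b) y (fun t => y (t - b))

/-- The words of length `m + b` obtained from the first `m` terms of `y` by one burst of `b`
insertions. -/
def insertions {α : Type*} (m b : ℕ) (y : ℕ → α) : Set (Fin (m + b) → α) :=
  {z | ∃ p ≤ m, z ∈ insertAt (m + b) b y p}

/-! ### Size of one insertion ball -/

theorem ncard_cylinder {α : Type*} [Fintype α] {n a c : ℕ} (hc : c ≤ n)
    (f g : ℕ → α) (hac : a ≤ c) :
    (cylinder n a c f g).ncard = Fintype.card α ^ (c - a) := by
  classical
  have h : cylinder n a c f g = ↑(Fintype.piFinset fun t : Fin n =>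
      if (t : ℕ) < a then {f t} else if c ≤ (t : ℕ) then {g t} else Finset.univ) := by
    ext z
    simp only [cylinder, Set.mem_ofPred_eq, Finset.mem_coe, Fintype.mem_piFinset]
    constructor
    · rintro ⟨h1, h2⟩ t
      split_ifs with h3 h4
      · simp [h1 t h3]
      · simp [h2 t h4]
      · simp
    · intro h
      refine ⟨fun t ht => ?_, fun t ht => ?_⟩
      · simpa [ht] using h t
      · have := h t
        rw [if_neg (by omega), if_pos ht] at this
        simpa using this
  rw [h, Set.ncard_coe_finset, Fintype.card_piFinset]
  have h2 : ∀ t : Fin n, (if (t : ℕ) < a then ({f t} : Finset α) else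
      if c ≤ (t : ℕ) then {g t} else Finset.univ).card =
      (fun s : ℕ => if s ∈ Finset.Ico a c then Fintype.card α else 1) t := by
    intro t
    simp only [Finset.mem_Ico]
    split_ifs <;> first | omega | simp
  rw [Finset.prod_congr rfl fun t _ => h2 t, Fin.prod_univ_eq_prod_range
    (fun s : ℕ => if s ∈ Finset.Ico a c then Fintype.card α else 1), Finset.prod_ite]
  have h3 : (Finset.range n).filter (fun s => s ∈ Finset.Ico a c) = Finset.Ico a c := by
    ext s; simp only [Finset.mem_filter, Finset.mem_range, Finset.mem_Ico]; omega
  rw [h3]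
  simp

theorem insertAt_inter_succ {α : Type*} {n b : ℕ} (y : ℕ → α) {p p' : ℕ} (h : p < p') :
    insertAt n b y p ∩ insertAt n b y p' ⊆ cylinder n (p + 1) (p + b) y (fun t => y (t - b)) := by
  rintro z ⟨h1, h2⟩
  exact ⟨fun t ht => h2.1 t (by omega), h1.2⟩

/-- Positions are added downwards from m. A word shared by position p and some later position is
already shared with p + 1, so each new position brings q^b words of which exactly q^(b-1) are old.
-/
theorem ncard_insertions_aux {α : Type*} [Fintype α] {m b : ℕ} (hb : 1 ≤ b) (y : ℕ → α) (k : ℕ)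
    (hk : k ≤ m) :
    {z | ∃ p, m - k ≤ p ∧ p ≤ m ∧ z ∈ insertAt (m + b) b y p}.ncard
      + k * Fintype.card α ^ (b - 1) = (k + 1) * Fintype.card α ^ b := by
  induction k with
  | zero =>
    have : {z | ∃ p, m - 0 ≤ p ∧ p ≤ m ∧ z ∈ insertAt (m + b) b y p} = insertAt (m + b) b y m := by
      ext z
      constructor
      · rintro ⟨p, h1, h2, h3⟩
        obtain rfl : p = m := by omega
        exact h3
      · exact fun h => ⟨m, by omega, le_rfl, h⟩
    rw [this, insertAt, ncard_cylinder (by omega) _ _ (by omega)]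
    simp
  | succ k ih =>
    have ih := ih (by omega)
    set S := {z | ∃ p, m - k ≤ p ∧ p ≤ m ∧ z ∈ insertAt (m + b) b y p}
    set p := m - (k + 1) with hp
    have h1 : {z | ∃ p, m - (k + 1) ≤ p ∧ p ≤ m ∧ z ∈ insertAt (m + b) b y p}
        = insertAt (m + b) b y p ∪ S := by
      ext z
      constructor
      · rintro ⟨p', h1, h2, h3⟩
        by_cases h : p' = p
        · left; rw [← h]; exact h3
        · right; exact ⟨p', by omega, h2, h3⟩
      · rintro (h | ⟨p', h1, h2, h3⟩)
        · exact ⟨p, le_rfl, by omega, h⟩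
        · exact ⟨p', by omega, h2, h3⟩
    have h2 : insertAt (m + b) b y p ∩ S
        = cylinder (m + b) (p + 1) (p + b) y (fun t => y (t - b)) := by
      apply Set.Subset.antisymm
      · rintro z ⟨h1, p', h2, h3, h4⟩
        exact insertAt_inter_succ y (show p < p' by omega) ⟨h1, h4⟩
      · intro z hz
        exact ⟨⟨fun t ht => hz.1 t (by omega), hz.2⟩, p + 1, by omega, by omega,
          hz.1, fun t ht => hz.2 t (by omega)⟩
    have h3 := Set.ncard_union_add_ncard_inter (insertAt (m + b) b y p) S
    rw [h2, ncard_cylinder (by omega) _ _ (by omega)] at h3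
    rw [insertAt, ncard_cylinder (by omega) _ _ (by omega), ← insertAt] at h3
    rw [h1]
    rw [show p + b - (p + 1) = b - 1 by omega, show p + b - p = b by omega] at h3
    linarith

theorem ncard_insertions {α : Type*} [Fintype α] {m b : ℕ} (hb : 1 ≤ b) (y : ℕ → α) :
    (insertions m b y).ncard + m * Fintype.card α ^ (b - 1) = (m + 1) * Fintype.card α ^ b := by
  have := ncard_insertions_aux hb y m le_rfl
  simpa [insertions] using this

/-! ### The ball as a union over deletion positions -/

theorem deleteBlock_succ_of_eq {α : Type*} {b : ℕ} {x : ℕ → α} {i : ℕ} (h : x i = x (i + b)) :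
    deleteBlock b x (i + 1) = deleteBlock b x i := by
  funext t
  unfold deleteBlock
  rcases lt_trichotomy t i with h1 | h1 | h1
  · rw [if_pos (by omega), if_pos h1]
  · subst h1; simp [h]
  · rw [if_neg (by omega), if_neg (by omega)]

/-- The words reached by deleting a block of `x` at a position below `i` and inserting a
block. -/
def partialBall {α : Type*} (m b : ℕ) (x : ℕ → α) (i : ℕ) : Set (Fin (m + b) → α) :=
  {z | ∃ j < i, z ∈ insertions m b (deleteBlock b x j)}

theorem partialBall_succ {α : Type*} (m b : ℕ) (x : ℕ → α) (i : ℕ) :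
    partialBall m b x (i + 1) = partialBall m b x i ∪ insertions m b (deleteBlock b x i) := by
  ext z
  constructor
  · rintro ⟨j, h1, h2⟩
    by_cases h : j = i
    · right; rw [← h]; exact h2
    · left; exact ⟨j, by omega, h2⟩
  · rintro (⟨j, h1, h2⟩ | h)
    · exact ⟨j, by omega, h2⟩
    · exact ⟨i, by omega, h⟩

/-- The words reached from the deletion at position `i + 1` that some deletion at an earlier
position reaches as well. -/
def overlap {α : Type*} (m b : ℕ) (x : ℕ → α) (i : ℕ) : Set (Fin (m + b) → α) :=
  partialBall m b x (i + 1) ∩ insertions m b (deleteBlock b x (i + 1))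

theorem ncard_partialBall {α : Type*} [Fintype α] {m b : ℕ} (hb : 1 ≤ b) (x : ℕ → α) (k : ℕ) :
    (partialBall m b x (k + 1)).ncard + ∑ i ∈ Finset.range k, (overlap m b x i).ncard
      + (k + 1) * (m * Fintype.card α ^ (b - 1)) = (k + 1) * ((m + 1) * Fintype.card α ^ b) := by
  induction k with
  | zero =>
    have : partialBall m b x 0 = ∅ := by ext z; simp [partialBall]
    rw [partialBall_succ, this, Set.empty_union]
    have := ncard_insertions (m := m) hb (deleteBlock b x 0)
    simpa using this
  | succ k ih =>
    have h1 := ncard_insertions (m := m) hb (deleteBlock b x (k + 1))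
    have h2 := Set.ncard_union_add_ncard_inter (partialBall m b x (k + 1))
      (insertions m b (deleteBlock b x (k + 1)))
    rw [← partialBall_succ, ← overlap] at h2
    rw [Finset.sum_range_succ]
    linarith

/-! ### Structure of the overlaps -/

/-- The common words of the insertion balls of `deleteBlock b x l` and
`deleteBlock b x (i + 1)` that start like the former and end like the latter. -/
def crossWords {α : Type*} (m b : ℕ) (x : ℕ → α) (i l : ℕ) : Set (Fin (m + b) → α) :=
  if l ≤ i ∧ i + 1 ≤ l + b then
    cylinder (m + b) (i + 1) (l + b) (deleteBlock b x l)
      (fun t => deleteBlock b x (i + 1) (t - b))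
  else ∅

/-- The number of words in `crossWords`. -/
def crossCount (q b i l : ℕ) : ℕ :=
  if l ≤ i ∧ i + 1 ≤ l + b then q ^ (l + b - (i + 1)) else 0

theorem ncard_crossWords {α : Type*} [Fintype α] {m b : ℕ} (x : ℕ → α) {i l : ℕ}
    (hl : l < m) :
    (crossWords m b x i l).ncard = crossCount (Fintype.card α) b i l := by
  unfold crossWords crossCount
  split_ifs with h
  · rw [ncard_cylinder (by omega) _ _ (by omega)]
  · simp

theorem ncard_straightWords {α : Type*} [Fintype α] {m b : ℕ} (hb : 1 ≤ b) (x : ℕ → α) {i : ℕ}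
    (hi : i < m) :
    (cylinder (m + b) (i + 1) (i + b) x x).ncard = Fintype.card α ^ (b - 1) := by
  rw [ncard_cylinder (by omega) _ _ (by omega)]
  congr 1; omega

theorem straightWords_subset_overlap {α : Type*} {m b : ℕ} (x : ℕ → α) {i : ℕ}
    (hi : i < m) : cylinder (m + b) (i + 1) (i + b) x x ⊆ overlap m b x i := by
  intro z hz
  refine ⟨⟨i, by omega, i, by omega, ?_, ?_⟩, i + 1, by omega, ?_, ?_⟩
  · intro t ht
    rw [hz.1 t (by omega), deleteBlock, if_pos ht]
  · intro t ht
    simp only [deleteBlock]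
    rw [hz.2 t ht, if_neg (by omega)]
    congr 1; omega
  · intro t ht
    rw [hz.1 t (by omega), deleteBlock, if_pos ht]
  · intro t ht
    simp only [deleteBlock]
    rw [hz.2 t (by omega), if_neg (by omega)]
    congr 1; omega

theorem crossWords_subset_overlap {α : Type*} {m b : ℕ} (x : ℕ → α) {i : ℕ}
    (hi : i < m) (l : ℕ) : crossWords m b x i l ⊆ overlap m b x i := by
  intro z hz
  unfold crossWords at hz
  split_ifs at hz with h
  · refine ⟨⟨l, by omega, i + 1, by omega, hz.1, ?_⟩, l, by omega, ?_, hz.2⟩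
    · intro t ht
      rw [hz.2 t (by omega)]
      simp only [deleteBlock]
      rw [if_neg (by omega), if_neg (by omega)]
    · intro t ht
      rw [hz.1 t (by omega)]
      simp only [deleteBlock]
      rw [if_pos (by omega), if_pos (by omega)]
  · exact hz.elim

/-- Position i carries x_i in the first set and x_{i+b} in the second. -/
theorem disjoint_straightWords_crossWords {α : Type*} {m b : ℕ} {x : ℕ → α} {i : ℕ}
    (hi : i < m) (h : x i ≠ x (i + b)) (l : ℕ) :
    Disjoint (cylinder (m + b) (i + 1) (i + b) x x) (crossWords m b x i l) := by
  rw [Set.disjoint_left]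
  intro z hz hz'
  unfold crossWords at hz'
  split_ifs at hz' with hl
  · have h1 := hz.1 ⟨i, by omega⟩ (Nat.lt_succ_self i)
    have h2 := hz'.1 ⟨i, by omega⟩ (Nat.lt_succ_self i)
    simp only [deleteBlock] at h2
    rw [if_neg (by omega)] at h2
    exact h (h1.symm.trans h2)
  · exact hz'.elim

/-- The smaller index decides: position l carries x_{l+b} in one set and x_l in the other. -/
theorem disjoint_crossWords {α : Type*} {m b : ℕ} {x : ℕ → α} {i l l' : ℕ} (hi : i < m)
    (h : x l ≠ x (l + b)) (hl : l < l') :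
    Disjoint (crossWords m b x i l) (crossWords m b x i l') := by
  rw [Set.disjoint_left]
  intro z hz hz'
  unfold crossWords at hz hz'
  split_ifs at hz hz' with h1 h2
  · have h1 := hz.1 ⟨l, by omega⟩ (show l < i + 1 by omega)
    have h2 := hz'.1 ⟨l, by omega⟩ (show l < i + 1 by omega)
    simp only [deleteBlock] at h1 h2
    rw [if_neg (by omega)] at h1
    rw [if_pos hl] at h2
    exact h (h2.symm.trans h1)
  all_goals first | exact hz'.elim | exact hz.elim

open Classical in
theorem le_ncard_overlap_of_ne {α : Type*} [Fintype α] {m b : ℕ} (hb : 1 ≤ b) {x : ℕ → α}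
    {i : ℕ} (hi : i < m) (h : x i ≠ x (i + b)) :
    Fintype.card α ^ (b - 1) + ∑ l ∈ (Finset.range m).filter (fun l => x l ≠ x (l + b)),
      crossCount (Fintype.card α) b i l ≤ (overlap m b x i).ncard := by
  set E := (Finset.range m).filter (fun l => x l ≠ x (l + b))
  have hE : ∀ l ∈ E, l < m ∧ x l ≠ x (l + b) := by
    intro l hl
    simpa [E] using hl
  have h1 : (⋃ l ∈ E, crossWords m b x i l).ncard
      = ∑ l ∈ E, crossCount (Fintype.card α) b i l := by
    have : (⋃ l ∈ E, crossWords m b x i l)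
        = ↑(E.biUnion fun l => (crossWords m b x i l).toFinset) := by
      ext z; simp
    rw [this, Set.ncard_coe_finset, Finset.card_biUnion]
    · refine Finset.sum_congr rfl fun l hl => ?_
      rw [← ncard_crossWords x (hE l hl).1, Set.ncard_eq_toFinset_card']
    · intro l hl l' hl' hne
      refine Set.disjoint_toFinset.2 ?_
      rcases lt_or_gt_of_ne hne with h' | h'
      · exact disjoint_crossWords hi (hE l hl).2 h'
      · exact (disjoint_crossWords hi (hE l' hl').2 h').symm
  rw [← h1, ← ncard_straightWords hb x hi, ← Set.ncard_union_eq]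
  · apply Set.ncard_le_ncard _ (Set.toFinite _)
    apply Set.union_subset (straightWords_subset_overlap x hi)
    exact Set.iUnion₂_subset fun l _ => crossWords_subset_overlap x hi l
  · simp only [Set.disjoint_iUnion_right]
    exact fun l _ => disjoint_straightWords_crossWords hi h l

theorem overlap_of_eq {α : Type*} {m b : ℕ} {x : ℕ → α} {i : ℕ} (h : x i = x (i + b)) :
    overlap m b x i = insertions m b (deleteBlock b x (i + 1)) := by
  rw [overlap, Set.inter_eq_right]
  intro z hz
  exact ⟨i, by omega, by rwa [← deleteBlock_succ_of_eq h]⟩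

theorem overlap_subset_of_separated {α : Type*} {m b : ℕ} {x : ℕ → α}
    (h1 : ∀ t < m, x t ≠ x (t + b)) (h2 : ∀ t, t + b < m → x t ≠ x (t + 2 * b)) {i : ℕ}
    (hi : i < m) :
    overlap m b x i ⊆ cylinder (m + b) (i + 1) (i + b) x x ∪
      ⋃ l ∈ Finset.range m, crossWords m b x i l := by
  rintro z ⟨⟨l, hl, p', hp', hz'⟩, p, hp, hz⟩
  -- If both insertions came after l, position l would carry both x_l and x_{l+b}.
  have hmin : p ≤ l ∨ p' ≤ l := by
    by_contra! hcon
    have e1 := hz.1 ⟨l, by omega⟩ hcon.1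
    have e2 := hz'.1 ⟨l, by omega⟩ hcon.2
    simp only [deleteBlock] at e1 e2
    rw [if_pos hl] at e1
    rw [if_neg (by omega)] at e2
    exact h1 l (by omega) (e1.symm.trans e2)
  -- If both came at or before i, position i + b would carry both x_i and x_{i+b}.
  have hmax : i + 1 ≤ p ∨ i + 1 ≤ p' := by
    by_contra! hcon
    have e1 := hz.2 ⟨i + b, by omega⟩ (show p + b ≤ i + b by omega)
    have e2 := hz'.2 ⟨i + b, by omega⟩ (show p' + b ≤ i + b by omega)
    simp only [deleteBlock, Nat.add_sub_cancel] at e1 e2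
    rw [if_pos (by omega)] at e1
    rw [if_neg (by omega)] at e2
    exact h1 i hi (e1.symm.trans e2)
  by_cases hpl : p ≤ l
  · right
    have hp'i : i + 1 ≤ p' := by omega
    -- Otherwise position l + b would carry both x_l and x_{l+2b}; only here is distance 2b needed.
    have hk : i + 1 ≤ l + b := by
      by_contra! hcon
      have e1 := hz.2 ⟨l + b, by omega⟩ (show p + b ≤ l + b by omega)
      have e2 := hz'.1 ⟨l + b, by omega⟩ (show l + b < p' by omega)
      simp only [deleteBlock, Nat.add_sub_cancel] at e1 e2
      rw [if_pos (by omega)] at e1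
      rw [if_neg (by omega), add_assoc, ← two_mul] at e2
      exact h2 l (by omega) (e1.symm.trans e2)
    simp only [Set.mem_iUnion, Finset.mem_range]
    refine ⟨l, by omega, ?_⟩
    rw [crossWords, if_pos ⟨by omega, hk⟩]
    exact ⟨fun t ht => hz'.1 t (by omega), fun t ht => hz.2 t (by omega)⟩
  · left
    constructor
    · intro t ht
      rw [hz.1 t (by omega), deleteBlock, if_pos ht]
    · intro t ht
      rw [hz'.2 t (by omega)]
      simp only [deleteBlock]
      rw [if_neg (by omega)]
      congr 1; omega

theorem ncard_overlap_le_of_separated {α : Type*} [Fintype α] {m b : ℕ} (hb : 1 ≤ b) {x : ℕ → α}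
    (h1 : ∀ t < m, x t ≠ x (t + b)) (h2 : ∀ t, t + b < m → x t ≠ x (t + 2 * b)) {i : ℕ}
    (hi : i < m) :
    (overlap m b x i).ncard ≤ Fintype.card α ^ (b - 1) +
      ∑ l ∈ Finset.range m, crossCount (Fintype.card α) b i l := by
  refine (Set.ncard_le_ncard (overlap_subset_of_separated h1 h2 hi) (Set.toFinite _)).trans ?_
  refine (Set.ncard_union_le _ _).trans ?_
  rw [ncard_straightWords hb x hi]
  refine Nat.add_le_add_left ((Finset.set_ncard_biUnion_le _ _).trans ?_) _
  exact Finset.sum_le_sum fun l hl => (ncard_crossWords x (Finset.mem_range.1 hl)).le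

/-! ### Summing the overlaps -/

theorem crossCount_eq_sum (q b i l : ℕ) :
    crossCount q b i l = ∑ r ∈ Finset.range b, if i + r + 1 = l + b then q ^ r else 0 := by
  unfold crossCount
  split_ifs with h
  · rw [Finset.sum_eq_single_of_mem (l + b - (i + 1)) (by simp; omega)]
    · rw [if_pos (by omega)]
    · intro r _ hr
      rw [if_neg (by omega)]
  · symm
    apply Finset.sum_eq_zero
    intro r hr
    rw [Finset.mem_range] at hr
    rw [if_neg (by omega)]

/-- For fixed i each exponent r < b occurs for at most one l, so a geometric sum dominates. -/
theorem sum_crossCount_right_lt {q b : ℕ} (hq : 2 ≤ q) (i : ℕ) (s : Finset ℕ) :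
    ∑ l ∈ s, crossCount q b i l < q ^ b := by
  refine lt_of_le_of_lt ?_ (Nat.geomSum_lt hq (s := Finset.range b) (n := b) (by simp))
  simp only [crossCount_eq_sum]
  rw [Finset.sum_comm]
  refine Finset.sum_le_sum fun r _ => ?_
  calc ∑ l ∈ s, (if i + r + 1 = l + b then q ^ r else 0)
      ≤ ∑ l ∈ s, (if l = i + r + 1 - b then q ^ r else 0) := by
        refine Finset.sum_le_sum fun l _ => ?_
        split_ifs <;> omega
    _ ≤ q ^ r := by
        rw [Finset.sum_ite_eq']
        split_ifs <;> simp

theorem sum_crossCount_left_lt {q b : ℕ} (hq : 2 ≤ q) (l : ℕ) (s : Finset ℕ) :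
    ∑ i ∈ s, crossCount q b i l < q ^ b := by
  refine lt_of_le_of_lt ?_ (Nat.geomSum_lt hq (s := Finset.range b) (n := b) (by simp))
  simp only [crossCount_eq_sum]
  rw [Finset.sum_comm]
  refine Finset.sum_le_sum fun r _ => ?_
  calc ∑ i ∈ s, (if i + r + 1 = l + b then q ^ r else 0)
      ≤ ∑ i ∈ s, (if i = l + b - (r + 1) then q ^ r else 0) := by
        refine Finset.sum_le_sum fun l _ => ?_
        split_ifs <;> omega
    _ ≤ q ^ r := by
        rw [Finset.sum_ite_eq']
        split_ifs <;> simp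

open Classical in
-- The last summand moves column i of `crossCount` to row i when x_i = x_{i+b}: exactly the terms
-- that the filter drops from all rows. There is room for it, since row and column are each below
-- q^b while the full insertion ball exceeds 2q^b + q^(b-1).
theorem le_ncard_overlap {α : Type*} [Fintype α] {m b : ℕ} (hb : 1 ≤ b) (hm : 3 ≤ m)
    (hq : 3 ≤ Fintype.card α) (x : ℕ → α) {i : ℕ} (hi : i < m) :
    Fintype.card α ^ (b - 1) + ∑ l ∈ (Finset.range m).filter (fun l => x l ≠ x (l + b)),
      crossCount (Fintype.card α) b i l +
      (if x i ≠ x (i + b) then 0 else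
        ∑ j ∈ Finset.range m, crossCount (Fintype.card α) b j i) ≤ (overlap m b x i).ncard := by
  split_ifs with h
  · exact le_ncard_overlap_of_ne hb hi h
  · push Not at h
    rw [overlap_of_eq h]
    have h1 := ncard_insertions (m := m) hb (deleteBlock b x (i + 1))
    have h2 := sum_crossCount_right_lt (b := b) (show 2 ≤ Fintype.card α by omega) i
      ((Finset.range m).filter (fun l => x l ≠ x (l + b)))
    have h3 := sum_crossCount_left_lt (b := b) (show 2 ≤ Fintype.card α by omega) i
      (Finset.range m)
    have h4 : Fintype.card α ^ b = Fintype.card α * Fintype.card α ^ (b - 1) := by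
      rw [← pow_succ']; congr 1; omega
    have h5 : 3 * Fintype.card α ^ (b - 1) ≤ Fintype.card α ^ b := by
      rw [h4]; exact Nat.mul_le_mul_right _ hq
    obtain ⟨k, rfl⟩ := Nat.exists_eq_add_of_le hm
    have h6 : k * (3 * Fintype.card α ^ (b - 1)) ≤ k * Fintype.card α ^ b :=
      Nat.mul_le_mul_left _ h5
    nlinarith

/-- The total overlap for a separated word. -/
def totalOverlap (q b m : ℕ) : ℕ :=
  ∑ i ∈ Finset.range m, (q ^ (b - 1) + ∑ l ∈ Finset.range m, crossCount q b i l)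

theorem totalOverlap_le {α : Type*} [Fintype α] {m b : ℕ} (hb : 1 ≤ b) (hm : 3 ≤ m)
    (hq : 3 ≤ Fintype.card α) (x : ℕ → α) :
    totalOverlap (Fintype.card α) b m ≤ ∑ i ∈ Finset.range m, (overlap m b x i).ncard := by
  classical
  refine le_trans (le_of_eq ?_)
    (Finset.sum_le_sum fun i hi => le_ncard_overlap hb hm hq x (Finset.mem_range.1 hi))
  simp only [totalOverlap, Finset.sum_add_distrib, add_assoc]
  congr 1
  -- Both double sums are regrouped by column l; each column is then counted once, by the filter or
  -- by the compensation.
  rw [Finset.sum_comm (s := Finset.range m)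
    (t := (Finset.range m).filter (fun l => x l ≠ x (l + b))), Finset.sum_comm,
    Finset.sum_filter, ← Finset.sum_add_distrib]
  refine Finset.sum_congr rfl fun l _ => ?_
  split_ifs <;> simp

/-- The exponent r corresponds to i - l = b - 1 - r, a difference attained by m - b + 1 + r pairs.
-/
theorem totalOverlap_eq {q b m : ℕ} (hbm : b ≤ m) :
    totalOverlap q b m
      = m * q ^ (b - 1) + ∑ r ∈ Finset.range b, (m - b + 1 + r) * q ^ r := by
  simp only [totalOverlap, Finset.sum_add_distrib, crossCount_eq_sum]
  congr 1
  · simp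
  · rw [Finset.sum_congr rfl fun i _ => Finset.sum_comm, Finset.sum_comm]
    refine Finset.sum_congr rfl fun r hr => ?_
    rw [Finset.mem_range] at hr
    rw [Finset.sum_comm]
    have : ∀ l, ∑ i ∈ Finset.range m, (if i + r + 1 = l + b then q ^ r else 0)
        = if l < m - b + 1 + r then q ^ r else 0 := by
      intro l
      have : ∀ i, (if i + r + 1 = l + b then q ^ r else 0)
          = if i = l + b - (r + 1) then q ^ r else 0 := by
        intro i
        exact if_congr (by omega) rfl rfl
      simp only [this, Finset.sum_ite_eq', Finset.mem_range]
      exact if_congr (by omega) rfl rfl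
    simp only [this]
    rw [← Finset.sum_filter]
    have h2 : (Finset.range m).filter (fun l => l < m - b + 1 + r)
        = Finset.range (m - b + 1 + r) := by
      ext l; simp only [Finset.mem_filter, Finset.mem_range]; omega
    rw [h2]; simp

theorem sum_linear_mul_pow (q d : ℝ) (hq : q ≠ 1) (c : ℕ) :
    ∑ r ∈ Finset.range c, (d + r) * q ^ r = (d + c) * (q ^ c - 1) / (q - 1)
      - (q ^ (c + 1) - q - c * (q - 1)) / (q - 1) ^ 2 := by
  have h : q - 1 ≠ 0 := sub_ne_zero.2 hq
  induction c with
  | zero => simp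
  | succ c ih =>
    rw [Finset.sum_range_succ, ih]
    push_cast
    field_simp
    ring

/-! ### From lists to indexed words -/

theorem burstDeletion_iff_burstInsertion {α : Type*} {b : ℕ} {y z : List α} :
    BurstDeletion b y z ↔ BurstInsertion b z y := by
  constructor
  · rintro ⟨u, v, w, h, h1, h2⟩
    exact ⟨u, v, w, h, h2, h1⟩
  · rintro ⟨u, v, w, h, h1, h2⟩
    exact ⟨u, v, w, h, h2, h1⟩

/-- Optional indexing turns concatenations into pointwise equations, the form used by `insertAt` and
`deleteBlock`. -/
theorem burstInsertion_iff {α : Type*} {b : ℕ} {y z : List α} :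
    BurstInsertion b y z ↔ z.length = y.length + b ∧ ∃ p ≤ y.length,
      (∀ t < p, z[t]? = y[t]?) ∧ ∀ t, p ≤ t → z[t + b]? = y[t]? := by
  constructor
  · rintro ⟨u, v, w, h, rfl, rfl⟩
    refine ⟨by simp; omega, u.length, by simp, fun t ht => ?_, fun t ht => ?_⟩
    · rw [List.append_assoc, List.getElem?_append_left ht, List.getElem?_append_left ht]
    · rw [List.getElem?_append_right (by simp; omega), List.getElem?_append_right ht]
      congr 1
      simp; omega
  · rintro ⟨hl, p, hp, h1, h2⟩
    refine ⟨y.take p, (z.drop p).take b, y.drop p, by simp; omega, by simp, ?_⟩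
    have e1 : y.take p = z.take p := by
      apply List.ext_getElem?
      intro t
      rw [List.getElem?_take, List.getElem?_take]
      split_ifs with h
      · exact (h1 t h).symm
      · rfl
    have e2 : y.drop p = (z.drop p).drop b := by
      apply List.ext_getElem?
      intro t
      rw [List.getElem?_drop, List.drop_drop, List.getElem?_drop, ← h2 (p + t) (by omega)]
      congr 1
      omega
    rw [e1, e2, List.append_assoc, List.take_append_drop, List.take_append_drop]

theorem mem_burstLevenshteinBall_one_iff {α : Type*} {m b : ℕ} (x : ℕ → α)
    (z : Fin (m + b) → α) :
    z ∈ burstLevenshteinBall b 1 (fun t : Fin (m + b) => x t) ↔ z ∈ partialBall m b x (m + 1) := by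
  have hx : ∀ t, t < m + b → (List.ofFn fun t : Fin (m + b) => x t)[t]? = some (x t) := by
    intro t ht
    simp [ht]
  have hz : ∀ t (ht : t < m + b), (List.ofFn z)[t]? = some (z ⟨t, ht⟩) := by
    intro t ht
    simp [ht]
  have hdel : ∀ y : List α, BurstDeletion b (List.ofFn fun t : Fin (m + b) => x t) y ↔
      ∃ i ≤ m, y = List.ofFn fun t : Fin m => deleteBlock b x i t := by
    intro y
    rw [burstDeletion_iff_burstInsertion, burstInsertion_iff]
    simp only [List.length_ofFn, Nat.add_right_cancel_iff]
    constructor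
    · rintro ⟨hl, i, hi, h1, h2⟩
      refine ⟨i, by omega, List.ext_getElem? fun t => ?_⟩
      by_cases ht : t < m
      · rw [List.getElem?_ofFn, dif_pos ht, deleteBlock]
        split_ifs with hti
        · rw [← h1 t hti, hx t (by omega)]
        · rw [← h2 t (not_lt.1 hti), hx _ (by omega)]
      · rw [List.getElem?_eq_none (by omega), List.getElem?_eq_none (by simp; omega)]
    · rintro ⟨i, hi, rfl⟩
      refine ⟨by simp, i, by simpa, fun t ht => ?_, fun t ht => ?_⟩
      · rw [hx t (by omega), List.getElem?_ofFn, dif_pos (by omega), deleteBlock, if_pos ht]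
      · by_cases htm : t < m
        · rw [hx _ (by omega), List.getElem?_ofFn, dif_pos htm, deleteBlock,
            if_neg (not_lt.2 ht)]
        · rw [List.getElem?_eq_none (by simp; omega), List.getElem?_eq_none (by simp; omega)]
  have hins : ∀ y : ℕ → α, BurstInsertion b (List.ofFn fun t : Fin m => y t) (List.ofFn z) ↔
      z ∈ insertions m b y := by
    intro y
    have hy : ∀ t, t < m → (List.ofFn fun t : Fin m => y t)[t]? = some (y t) := by
      intro t ht
      simp [ht]
    rw [burstInsertion_iff]
    simp only [List.length_ofFn, true_and]
    refine exists_congr fun p => and_congr_right fun hp => ?_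
    constructor
    · rintro ⟨h1, h2⟩
      refine ⟨fun t ht => ?_, fun t ht => ?_⟩
      · have := h1 t ht
        rw [hz t t.2, hy t (by omega)] at this
        simpa using this
      · have := h2 (t - b) (by omega)
        rw [show (t : ℕ) - b + b = t by omega, hz t t.2, hy _ (by omega)] at this
        simpa using this
    · rintro ⟨h1, h2⟩
      refine ⟨fun t ht => ?_, fun t ht => ?_⟩
      · rw [hz t (by omega), hy t (by omega), h1 ⟨t, _⟩ ht]
      · by_cases htm : t < m
        · rw [hz (t + b) (by omega), hy t htm, h2 ⟨t + b, _⟩ (Nat.add_le_add_right ht b)]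
          simp
        · rw [List.getElem?_eq_none (by simp; omega), List.getElem?_eq_none (by simp; omega)]
  have hball : z ∈ burstLevenshteinBall b 1 (fun t : Fin (m + b) => x t) ↔
      ∃ y, BurstDeletion b (List.ofFn fun t : Fin (m + b) => x t) y ∧
        BurstInsertion b y (List.ofFn z) := by
    simp [burstLevenshteinBall, burstDeletionBall, burstInsertionBall]
  rw [hball]
  simp only [hdel]
  constructor
  · rintro ⟨y, ⟨i, hi, rfl⟩, h⟩
    exact ⟨i, by omega, (hins _).1 h⟩
  · rintro ⟨i, hi, h⟩
    exact ⟨_, ⟨i, by omega, rfl⟩, (hins _).2 h⟩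

theorem exists_extension {α : Type*} {n : ℕ} (hn : 0 < n) (x : Fin n → α) :
    ∃ x' : ℕ → α, x = fun t : Fin n => x' t :=
  ⟨fun t => if h : t < n then x ⟨t, h⟩ else x ⟨0, hn⟩, by funext t; simp⟩

/-! ### Bounds, attainment and asymptotics -/

theorem ncard_ball_le {q b m : ℕ} (hb : 1 ≤ b) (x : Fin (m + b) → Fin q) :
    (burstLevenshteinBall b 1 x).ncard + (m + 1) * (m * q ^ (b - 1))
      ≤ (m + 1) * ((m + 1) * q ^ b) := by
  obtain ⟨x, rfl⟩ := exists_extension (by omega) x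
  have h := ncard_partialBall (m := m) hb x m
  rw [Fintype.card_fin] at h
  rw [show burstLevenshteinBall b 1 (fun t : Fin (m + b) => x t) = partialBall m b x (m + 1) from
    Set.ext (mem_burstLevenshteinBall_one_iff x)]
  omega

theorem ncard_ball_add_totalOverlap_le {q b m : ℕ} (hb : 1 ≤ b) (hm : 3 ≤ m) (hq : 3 ≤ q)
    (x : Fin (m + b) → Fin q) :
    (burstLevenshteinBall b 1 x).ncard + totalOverlap q b m + (m + 1) * (m * q ^ (b - 1))
      ≤ (m + 1) * ((m + 1) * q ^ b) := by
  obtain ⟨x, rfl⟩ := exists_extension (by omega) x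
  have h := ncard_partialBall (m := m) hb x m
  have h' := totalOverlap_le hb hm (by simpa using hq) x
  rw [Fintype.card_fin] at h h'
  rw [show burstLevenshteinBall b 1 (fun t : Fin (m + b) => x t) = partialBall m b x (m + 1) from
    Set.ext (mem_burstLevenshteinBall_one_iff x)]
  omega

theorem le_ncard_ball_add_totalOverlap {q b m : ℕ} (hb : 1 ≤ b)
    (x : Fin (m + b) → Fin q) (hx : SeparatedWord b x) :
    (m + 1) * ((m + 1) * q ^ b) ≤
      (burstLevenshteinBall b 1 x).ncard + totalOverlap q b m + (m + 1) * (m * q ^ (b - 1)) := by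
  obtain ⟨x, rfl⟩ := exists_extension (by omega) x
  have h := ncard_partialBall (m := m) hb x m
  have h' : ∑ i ∈ Finset.range m, (overlap m b x i).ncard ≤ totalOverlap (Fintype.card (Fin q)) b m :=
    Finset.sum_le_sum fun i hi => ncard_overlap_le_of_separated hb
      (fun t ht => hx.1 ⟨t, by omega⟩ ⟨t + b, by omega⟩ rfl)
      (fun t ht => hx.2 ⟨t, by omega⟩ ⟨t + 2 * b, by omega⟩ rfl) (Finset.mem_range.1 hi)
  rw [Fintype.card_fin] at h h'
  rw [show burstLevenshteinBall b 1 (fun t : Fin (m + b) => x t) = partialBall m b x (m + 1) from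
    Set.ext (mem_burstLevenshteinBall_one_iff x)]
  omega

theorem generalBound_eq {q b m : ℕ} (hb : 1 ≤ b) :
    generalBound q b (m + b)
      = (m + 1) * ((m + 1) * (q : ℝ) ^ b) - (m + 1) * (m * (q : ℝ) ^ (b - 1)) := by
  obtain ⟨c, rfl⟩ := Nat.exists_eq_add_of_le' hb
  simp only [generalBound, Nat.add_sub_cancel]
  push_cast
  ring

theorem sharpBound_eq {q b m : ℕ} (hb : 1 ≤ b) (hq : 2 ≤ q) (hbm : b ≤ m) :
    sharpBound q b (m + b)
      = (m + 1) * ((m + 1) * (q : ℝ) ^ b) - (m + 1) * (m * (q : ℝ) ^ (b - 1))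
        - totalOverlap q b m := by
  have hq1 : (q : ℝ) ≠ 1 := by
    have : (2 : ℝ) ≤ q := by exact_mod_cast hq
    linarith
  have h : (q : ℝ) - 1 ≠ 0 := sub_ne_zero.2 hq1
  rw [totalOverlap_eq hbm]
  push_cast [Nat.cast_sub hbm]
  rw [sum_linear_mul_pow _ _ hq1]
  obtain ⟨c, rfl⟩ := Nat.exists_eq_add_of_le' hb
  simp only [sharpBound, Nat.add_sub_cancel]
  push_cast
  field_simp
  ring

theorem exists_separatedWord {q b n : ℕ} (hb : 1 ≤ b) (hq : 3 ≤ q) :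
    ∃ x : Fin n → Fin q, SeparatedWord b x := by
  -- Constant blocks of length b cycle through three letters, so shifts by b and 2b change the
  -- letter by 1 and 2 modulo 3.
  refine ⟨fun i => ⟨i / b % 3, by omega⟩, fun i j h => ?_, fun i j h => ?_⟩
  · rw [ne_eq, Fin.mk.injEq, h, Nat.add_div_right _ hb]
    omega
  · rw [ne_eq, Fin.mk.injEq, h, Nat.add_mul_div_right _ _ hb]
    omega

theorem isBigO_affine (A B : ℝ) : (fun n : ℕ => A * n + B) =O[atTop] fun n : ℕ => (n : ℝ) := by
  refine ((isBigO_refl _ _).const_mul_left A).add ?_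
  refine IsBigO.of_bound |B| (eventually_atTop.2 ⟨1, fun n hn => ?_⟩)
  have : (1 : ℝ) ≤ n := by exact_mod_cast hn
  rw [Real.norm_eq_abs, Real.norm_of_nonneg (by positivity)]
  exact le_mul_of_one_le_right (abs_nonneg _) this

theorem theorem3 (q b : ℕ) (hb : 2 ≤ b) :
    (∀ n : ℕ, 2 * b + 1 ≤ n → ∀ x : Fin n → Fin q,
      ((burstLevenshteinBall b 1 x).ncard : ℝ) ≤ generalBound q b n) ∧
    (fun n : ℕ => generalBound q b n - (q : ℝ) ^ (b - 1) * ((q : ℝ) - 1) * (n : ℝ) ^ 2)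
      =O[atTop] (fun n : ℕ => (n : ℝ)) ∧
    (3 ≤ q →
      (∀ n : ℕ, 2 * b + 1 ≤ n → ∀ x : Fin n → Fin q,
        ((burstLevenshteinBall b 1 x).ncard : ℝ) ≤ sharpBound q b n) ∧
      (∀ n : ℕ, 2 * b + 1 ≤ n → ∀ x : Fin n → Fin q, SeparatedWord b x →
        ((burstLevenshteinBall b 1 x).ncard : ℝ) = sharpBound q b n) ∧
      (∀ n : ℕ, 2 * b + 1 ≤ n → ∃ x : Fin n → Fin q, SeparatedWord b x) ∧
      (fun n : ℕ => sharpBound q b n - (q : ℝ) ^ (b - 1) * ((q : ℝ) - 1) * (n : ℝ) ^ 2)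
        =O[atTop] (fun n : ℕ => (n : ℝ))) := by
  have hb1 : 1 ≤ b := by omega
  refine ⟨fun n hn x => ?_, ?_, fun hq => ⟨fun n hn x => ?_, fun n hn x hx => ?_,
    fun n _ => exists_separatedWord hb1 hq, ?_⟩⟩
  · obtain ⟨m, rfl⟩ := Nat.exists_eq_add_of_le' (show b ≤ n by omega)
    rw [generalBound_eq hb1, le_sub_iff_add_le]
    exact_mod_cast ncard_ball_le hb1 x
  · convert isBigO_affine ((q : ℝ) ^ (b - 1) * (1 + 2 * (1 - b) * (q - 1)))
      ((q : ℝ) ^ (b - 1) * (1 - b) * ((1 - b) * (q - 1) + 1)) using 2 with n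
    simp only [generalBound]
    ring
  · obtain ⟨m, rfl⟩ := Nat.exists_eq_add_of_le' (show b ≤ n by omega)
    rw [sharpBound_eq hb1 (by omega) (by omega), le_sub_iff_add_le, le_sub_iff_add_le]
    exact_mod_cast ncard_ball_add_totalOverlap_le hb1 (by omega) hq x
  · obtain ⟨m, rfl⟩ := Nat.exists_eq_add_of_le' (show b ≤ n by omega)
    rw [sharpBound_eq hb1 (by omega) (by omega), eq_sub_iff_add_eq, eq_sub_iff_add_eq]
    exact_mod_cast le_antisymm (ncard_ball_add_totalOverlap_le hb1 (by omega) hq x)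
      (le_ncard_ball_add_totalOverlap hb1 x hx)
  · convert isBigO_affine
      ((q : ℝ) ^ (b - 1) * (2 * (1 - b) * (q - 1) - 1) - ((q : ℝ) ^ (b - 1) - 1) / (q - 1))
      ((q : ℝ) ^ (b - 1) * (1 - b) * ((1 - b) * (q - 1) - 1) + 2 * (q : ℝ) ^ (b - 1)
        + b * ((q : ℝ) ^ (b - 1) - 1) / (q - 1)
        + ((q : ℝ) ^ b - q - ((b : ℝ) - 1) * ((q : ℝ) - 1)) / ((q : ℝ) - 1) ^ 2) using 2 with n
    simp only [sharpBound]
    ring
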